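/- All graphs are simple. Let $G$ be a connected graph with $m$ edges. An Eulerian circuit of $G$ is a closed walk that traverses every edge exactly once. Two Eulerian circuits $u,v_1,\dots,v_{m-1},u$ and $u,w_1,\dots,w_{m-1},u$ with the same starting vertex $u$ are called avoiding if, for every $1\le i\le m-1$, the vertices $v_i$ and $w_i$ are distinct and not adjacent. The graph $G$ is doubly Eulerian if from every vertex $u$ of $G$ there start two avoiding Eulerian circuits; a doubly Eulerian graph is edge-maximal if no doubly Eulerian graph of the same order has more edges. A circulant graph of order $n$ is a graph on $\mathbb{Z}_n$ for which there is a set $S\subseteq\mathbb{Z}_n$ such that distinct vertices $x,y$ are adjacent if and only if $x-y\in S$ or $y-x\in S$. Theorem. For every $n\equiv 2\pmod 4$ with $n\ge 10$, there exists an edge-maximal doubly Eulerian circulant graph of order $n$ which is regular of degree $n-4$. -/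

import Mathlib

universe u

/-- Two closed walks at the same vertex are avoiding if, at every step other than the first and the
last, they are at distinct and non-adjacent vertices. (Applied below only to Eulerian circuits,
which all have the same length, the number of edges of the graph.) -/
def SimpleGraph.Walk.Avoiding {V : Type u} {G : SimpleGraph V} {x : V} (p q : G.Walk x x) : Prop :=
  ∀ i : ℕ, 0 < i → i < p.length →
    p.getVert i ≠ q.getVert i ∧ ¬ G.Adj (p.getVert i) (q.getVert i)

open Classical in
/-- A connected graph is doubly Eulerian if from every vertex there start two avoiding Eulerian
circuits. -/
def SimpleGraph.IsDoublyEulerian {V : Type u} (G : SimpleGraph V) : Prop :=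
  G.Connected ∧
    ∀ x : V, ∃ p q : G.Walk x x, p.IsEulerian ∧ q.IsEulerian ∧ p.Avoiding q

/-- A doubly Eulerian graph is edge-maximal if no doubly Eulerian graph of the same order has more
edges. (Doubly Eulerian graphs are finite and non-empty, so that `Nat.card` is the order and
`Set.ncard` the number of edges.) -/
def SimpleGraph.IsEdgeMaximalDoublyEulerian {V : Type u} (G : SimpleGraph V) : Prop :=
  G.IsDoublyEulerian ∧
    ∀ (W : Type u) (H : SimpleGraph W), Nat.card W = Nat.card V → H.IsDoublyEulerian →
      H.edgeSet.ncard ≤ G.edgeSet.ncard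

/-!
The complement of a doubly Eulerian graph of even order `n` has odd degrees.  It cannot have a
vertex of degree `1`: whenever one of two avoiding circuits is at such a vertex, the other one is
at its only neighbour in the complement, and counting visits for circuits that start at this vertex
and at a third one gives a contradiction (`IsDoublyEulerian.degree_add_four_le`).  So all degrees
of the graph are at most `n - 4`.

For the converse let `n = 2 * N` with `N` odd, and let `G` be the circulant graph in which `x` is
not adjacent to `x + N - 1`, `x + N` and `x + N + 1`.  The translation by `N` is an automorphism of
`G`.  Applying it to the second circuit turns the task into the following one: find an Eulerian
circuit `p` at `0` and an Eulerian circuit `q` at `N` such that at all times but the first and the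
last `p - q` is `0`, `1` or `-1`.  The circuits begin with
* `p`: `0, 2, 1, N - 1, N - 3, …, 2, N,     N - 2, …, 3, 1`
* `q`: `N, 2, 0, N - 2, N - 4, …, 1, N - 1, N - 3, …, 2, 1`

and they end with the steps from `N - 2` to `0` and to `N`.  These two pieces use the same edges,
namely the edges `{i, i + 2}` and `{i, i + N - 2}` with both ends among `0, …, N`, and `{1, 2}`
(`exists_detour`).  In between, both walks follow one trail from `1` to `N - 2` that uses all other
edges of `G`.  It exists by Euler's theorem (`exists_isTrail_forall_mem_edges`), since the
remaining graph contains the Hamiltonian path `2, 3, …, n - 1, 0, 1`, and its odd vertices are the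
ends `N - 2` and `1` of the trail formed by the edges that were removed.
-/

/-! ### Eulerian trails -/

namespace SimpleGraph

/-- The edges at `x` are those on a trail `p` and those that remain when the edges of `p` are
deleted. -/
lemma Walk.IsTrail.ncard_incidenceSet {V : Type*} [Finite V] [DecidableEq V] {G : SimpleGraph V}
    {a b : V} {p : G.Walk a b} (hp : p.IsTrail) (x : V) :
    (G.incidenceSet x).ncard =
      ((G.deleteEdges p.edgeSet).incidenceSet x).ncard + p.edges.countP fun e => x ∈ e := by
  have h1 : G.incidenceSet x =
      (G.deleteEdges p.edgeSet).incidenceSet x ∪ {e | e ∈ p.edges ∧ x ∈ e} := by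
    ext e
    have := @Walk.edges_subset_edgeSet _ _ _ _ p e
    simp only [incidenceSet, edgeSet_deleteEdges, Set.mem_union, Set.mem_ofPred_eq, Set.mem_sdiff,
      Walk.mem_edgeSet]
    tauto
  have h2 : ({e | e ∈ p.edges ∧ x ∈ e} : Set (Sym2 V)).ncard =
      p.edges.countP fun e => x ∈ e := by
    rw [List.countP_eq_length_filter,
      ← List.toFinset_card_of_nodup (List.Nodup.filter _ hp.edges_nodup), ← Set.ncard_coe_finset]
    congr 1
    ext e
    simp
  rw [h1, Set.ncard_union_eq _ (Set.toFinite _) (Set.toFinite _), h2]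
  rw [Set.disjoint_left]
  rintro e he ⟨h, -⟩
  simp only [incidenceSet, edgeSet_deleteEdges, Set.mem_sdiff, Walk.mem_edgeSet,
    Set.mem_ofPred_eq] at he
  exact he.1.2 h

/-- From every vertex of a finite graph there starts a trail that cannot be prolonged. -/
lemma exists_isTrail_not_extendable {V : Type*} [Finite V] (G : SimpleGraph V) (a : V) :
    ∃ (b : V) (p : G.Walk a b), p.IsTrail ∧ ∀ e ∈ G.incidenceSet b, e ∈ p.edges := by
  classical
  have := Fintype.ofFinite V
  let P : ℕ → Prop := fun k => ∃ (b : V) (p : G.Walk a b), p.IsTrail ∧ p.length = k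
  have hP : P (Nat.findGreatest P G.edgeFinset.card) :=
    Nat.findGreatest_spec (m := 0) (Nat.zero_le _) ⟨a, .nil, by simp, rfl⟩
  obtain ⟨b, p, hp, hlen⟩ := hP
  refine ⟨b, p, hp, ?_⟩
  rintro e ⟨he, hbe⟩
  by_contra hne
  obtain ⟨c, rfl⟩ := hbe
  replace he : G.Adj b c := he
  have ht : (p.concat (v := b) (w := c) he).IsTrail := by
    rw [Walk.isTrail_def, Walk.edges_concat, List.concat_eq_append, List.nodup_append]
    refine ⟨hp.edges_nodup, by simp, ?_⟩
    rintro e he _ hf rfl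
    rw [List.mem_singleton] at hf
    exact hne (hf ▸ he)
  have := Nat.le_findGreatest (P := P) (ht.length_le_card_edgeFinset) ⟨c, _, ht, rfl⟩
  rw [Walk.length_concat] at this
  omega

/-- **Euler's theorem**, for trails from `a` to `b`: the two ends may coincide.  The degree of `x`
is written as the cardinality of `G.incidenceSet x`. -/
theorem exists_isTrail_forall_mem_edges {V : Type*} [Finite V] {G : SimpleGraph V}
    (hG : G.Preconnected) (a b : V)
    (hdeg : ∀ x, Even (G.incidenceSet x).ncard ↔ (a ≠ b → x ≠ a ∧ x ≠ b)) :
    ∃ p : G.Walk a b, p.IsTrail ∧ ∀ e ∈ G.edgeSet, e ∈ p.edges := by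
  classical
  have := Fintype.ofFinite V
  -- A trail that uses up the edges at its end leaves that vertex with no edge.
  have hzero : ∀ (H : SimpleGraph V) {u v : V} (p : H.Walk u v),
      (∀ e ∈ H.incidenceSet v, e ∈ p.edges) →
      ((H.deleteEdges p.edgeSet).incidenceSet v).ncard = 0 := by
    intro H u v p h
    rw [Set.ncard_eq_zero]
    ext e
    have := h e
    simp only [incidenceSet, edgeSet_deleteEdges, Set.mem_sdiff, Walk.mem_edgeSet,
      Set.mem_ofPred_eq, Set.mem_empty_iff_false] at this ⊢
    tauto
  let P : ℕ → Prop := fun k => ∃ p : G.Walk a b, p.IsTrail ∧ p.length = k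
  have h0 : ∃ p : G.Walk a b, p.IsTrail := by
    obtain ⟨c, p, hp, hmax⟩ := exists_isTrail_not_extendable G a
    have h1 := hp.ncard_incidenceSet c
    rw [hzero G p hmax, zero_add] at h1
    have h2 := hp.even_countP_edges_iff c
    have h3 := hdeg c
    rw [h1, h2] at h3
    have : c = b := by
      by_cases hac : a = c <;> by_cases hab : a = b <;> grind
    subst this
    exact ⟨p, hp⟩
  obtain ⟨p0, hp0⟩ := h0
  have hP : P (Nat.findGreatest P G.edgeFinset.card) :=
    Nat.findGreatest_spec (m := p0.length) hp0.length_le_card_edgeFinset ⟨p0, hp0, rfl⟩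
  obtain ⟨p, hp, hlen⟩ := hP
  refine ⟨p, hp, ?_⟩
  by_contra! hmiss
  obtain ⟨e, he, hep⟩ := hmiss
  have hx : ∃ x ∈ p.support, ∃ y, G.Adj x y ∧ s(x, y) ∉ p.edges := by
    by_contra! hall
    have hsup : ∀ {u v : V} (w : G.Walk u v), u ∈ p.support → v ∈ p.support := by
      intro u v w
      induction w with
      | nil => exact id
      | cons h w ih =>
        exact fun hu => ih (p.snd_mem_support_of_mem_edges (hall _ hu _ h))
    induction e with
    | h z z' =>
      obtain ⟨w⟩ := hG a z
      exact hep (hall z (hsup w p.start_mem_support) z' he)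
  obtain ⟨x, hxp, y, hxy, hxyp⟩ := hx
  -- The remaining graph has even degrees, so a maximal trail from `x` in it closes up.
  set H := G.deleteEdges p.edgeSet with hH
  obtain ⟨c, r, hr, hrmax⟩ := exists_isTrail_not_extendable H x
  have h1 := hr.ncard_incidenceSet c
  rw [hzero H r hrmax, zero_add] at h1
  have h2 := hr.even_countP_edges_iff c
  have h3 := hp.ncard_incidenceSet c
  have h4 := hp.even_countP_edges_iff c
  have h5 := hdeg c
  have hxc : x = c := by
    rw [h3, Nat.even_add, ← hH, h4, h1, h2] at h5
    by_contra hxc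
    have : ¬ (x ≠ c → c ≠ x ∧ c ≠ c) := fun h => (h hxc).2 rfl
    tauto
  subst hxc
  have hyr : s(x, y) ∈ r.edges := by
    apply hrmax
    refine ⟨?_, Sym2.mem_mk_left _ _⟩
    rw [hH, edgeSet_deleteEdges]
    exact ⟨hxy, hxyp⟩
  have hle : H ≤ G := deleteEdges_le _
  let q : G.Walk a b := ((p.takeUntil x hxp).append (r.mapLe hle)).append (p.dropUntil x hxp)
  have hperm : q.edges.Perm (r.edges ++ p.edges) := by
    have : p.edges = (p.takeUntil x hxp).edges ++ (p.dropUntil x hxp).edges := by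
      rw [← Walk.edges_append, Walk.take_spec]
    rw [this, Walk.edges_append, Walk.edges_append, Walk.edges_mapLe_eq_edges]
    rw [← List.append_assoc]
    exact (List.perm_append_comm).append_right _
  have hq : q.IsTrail := by
    rw [Walk.isTrail_def, hperm.nodup_iff, List.nodup_append]
    refine ⟨hr.edges_nodup, hp.edges_nodup, ?_⟩
    rintro e he _ hf rfl
    have := r.edges_subset_edgeSet he
    rw [hH, edgeSet_deleteEdges] at this
    exact this.2 hf
  have hge := Nat.le_findGreatest (P := P) hq.length_le_card_edgeFinset ⟨q, hq, rfl⟩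
  have hl := hperm.length_eq
  have hpos := List.length_pos_of_mem hyr
  rw [List.length_append, Walk.length_edges, p.length_edges] at hl
  omega

end SimpleGraph

/-! ### The upper bound -/

namespace SimpleGraph

open Finset

/-- Each visit of a walk to `x` is counted once for the edge that leaves `x` and once for the edge
that enters it. -/
lemma Walk.countP_edges_eq {V : Type*} [DecidableEq V] {G : SimpleGraph V} {u v : V}
    (p : G.Walk u v) (x : V) :
    (p.edges.countP fun e => x ∈ e) =
      (∑ i ∈ range p.length, (Pi.single x 1 : V → ℕ) (p.getVert i)) +
        ∑ i ∈ range p.length, (Pi.single x 1 : V → ℕ) (p.getVert (i + 1)) := by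
  induction p with
  | nil => simp
  | @cons u v w h p ih =>
    rw [Walk.edges_cons, List.countP_cons, ih, Walk.length_cons,
      sum_range_succ' (fun i => (Pi.single x 1 : V → ℕ) ((Walk.cons h p).getVert i))]
    simp only [Walk.getVert_cons_succ, Walk.getVert_zero]
    rw [sum_range_succ' (fun i => (Pi.single x 1 : V → ℕ) (p.getVert i)),
      Walk.getVert_zero]
    have := h.ne
    simp only [Pi.single_apply, Sym2.mem_iff, decide_eq_true_eq]
    split_ifs <;> grind

open Classical in
/-- The times, other than the first and the last, at which a walk is at `x`. -/
noncomputable def Walk.visits {V : Type*} {G : SimpleGraph V} {u v : V} (p : G.Walk u v)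
    (x : V) : Finset ℕ :=
  {i ∈ Ioo 0 p.length | p.getVert i = x}

lemma Walk.mem_visits {V : Type*} {G : SimpleGraph V} {u v : V} {p : G.Walk u v} {x : V} {i : ℕ} :
    i ∈ p.visits x ↔ (0 < i ∧ i < p.length) ∧ p.getVert i = x := by
  classical
  simp [Walk.visits]

open Classical in
lemma Walk.countP_edges_eq_two_mul {V : Type*} {G : SimpleGraph V} {u : V} (p : G.Walk u u)
    (hp : 0 < p.length) (x : V) :
    (p.edges.countP fun e => x ∈ e) = 2 * (#(p.visits x) + if u = x then 1 else 0) := by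
  have h1 : ∑ i ∈ range p.length, (Pi.single x 1 : V → ℕ) (p.getVert i) =
      #(p.visits x) + if u = x then 1 else 0 := by
    have : range p.length = insert 0 (Ioo 0 p.length) := by ext; simp; omega
    rw [this, sum_insert (by simp), Walk.getVert_zero, Walk.visits, card_filter, add_comm]
    simp [Pi.single_apply]
  have h2 := sum_range_succ (fun i => (Pi.single x 1 : V → ℕ) (p.getVert i)) p.length
  rw [sum_range_succ', Walk.getVert_zero, Walk.getVert_length] at h2
  rw [Walk.countP_edges_eq]
  omega

open Classical in
lemma Walk.IsEulerian.degree_eq {V : Type*} [Fintype V] {G : SimpleGraph V} {u : V}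
    {p : G.Walk u u} (hp : p.IsEulerian) (h : 0 < p.length) (x : V) :
    G.degree x = 2 * (#(p.visits x) + if u = x then 1 else 0) := by
  rw [← p.countP_edges_eq_two_mul h, ← card_incidenceFinset_eq_degree,
    incidenceFinset_eq_filter, ← hp.edgesFinset_eq, List.countP_eq_length_filter,
    ← List.toFinset_card_of_nodup (List.Nodup.filter _ hp.isTrail.edges_nodup)]
  congr 1
  ext e
  have : e ∈ hp.isTrail.edgesFinset ↔ e ∈ p.edges := Iff.rfl
  simp [this]

open Classical in
/-- A vertex `x` of degree `n - 2` has a single non-neighbour `y`.  While one circuit is at `x`, the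
other is at `y`.  Circuits from a third vertex show that `y` has degree at least `n - 2`, so that
`x` is its single non-neighbour, and circuits from `x` visit `x` less often than `y`. -/
lemma IsDoublyEulerian.degree_add_four_le {V : Type*} [Fintype V] {G : SimpleGraph V}
    (hG : G.IsDoublyEulerian) (heven : Even (Fintype.card V)) (hcard : 4 ≤ Fintype.card V) (x : V) :
    G.degree x + 4 ≤ Fintype.card V := by
  obtain ⟨hconn, hwalk⟩ := hG
  have : Nontrivial V := Fintype.one_lt_card_iff_nontrivial.mp (by omega)
  have hpos : ∀ {z : V} {p : G.Walk z z}, p.IsEulerian → 0 < p.length := by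
    intro z p hp
    obtain ⟨y, hy⟩ := hconn.preconnected.exists_adj_of_nontrivial z
    have := hp.mem_edges_iff.mpr (G.mem_edgeSet.mpr hy)
    rw [← Walk.length_edges]
    exact List.length_pos_of_mem this
  have hev : ∀ v, Even (G.degree v) := by
    intro v
    obtain ⟨p, q, hp, hq, hpq⟩ := hwalk v
    rw [hp.degree_eq (hpos hp)]
    exact even_two_mul _
  have hlt := G.degree_lt_card_verts
  by_contra hcon
  have hgood : ∀ v : V, G.degree v + 2 ≤ Fintype.card V := by
    intro v
    have := hlt v
    have := hev v
    grind
  have hx : G.degree x + 2 = Fintype.card V := by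
    have := hgood x
    have := hev x
    grind
  have huniq : ∀ v, G.degree v + 2 = Fintype.card V →
      ∃ y, y ≠ v ∧ ∀ z, v ≠ z ∧ ¬ G.Adj v z ↔ z = y := by
    intro v hv
    have h1 : Gᶜ.degree v = 1 := by
      rw [degree_compl]
      omega
    rw [degree_eq_one_iff_existsUnique_adj] at h1
    obtain ⟨y, hy, huy⟩ := h1
    rw [compl_adj] at hy
    refine ⟨y, hy.1.symm, fun z => ⟨fun hz => huy z ((compl_adj ..).mpr hz), ?_⟩⟩
    rintro rfl
    exact hy
  obtain ⟨y, hyx, hy⟩ := huniq x hx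
  have hlen : ∀ {z : V} {p q : G.Walk z z}, p.IsEulerian → q.IsEulerian →
      p.length = q.length := by
    intro z p q hp hq
    rw [← Walk.length_edges, ← Walk.length_edges]
    exact congrArg Finset.card (hp.edgesFinset_eq.trans hq.edgesFinset_eq.symm)
  have hxy : G.degree x ≤ G.degree y := by
    obtain ⟨z, hz⟩ : ∃ z, z ∉ ({x, y} : Finset V) := by
      by_contra! h
      have h1 := Finset.card_le_card (fun z _ => h z : (univ : Finset V) ⊆ {x, y})
      have h2 := Finset.card_le_two (a := x) (b := y)
      rw [card_univ] at h1
      omega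
    simp only [mem_insert, mem_singleton, not_or] at hz
    obtain ⟨p, q, hp, hq, hpq⟩ := hwalk z
    rw [hp.degree_eq (hpos hp), hq.degree_eq (hpos hq), if_neg hz.1, if_neg hz.2]
    have : p.visits x ⊆ q.visits y := by
      intro i hi
      rw [Walk.mem_visits] at hi ⊢
      have := hpq i hi.1.1 hi.1.2
      rw [hi.2, hy] at this
      exact ⟨⟨hi.1.1, hlen hp hq ▸ hi.1.2⟩, this⟩
    have := Finset.card_le_card this
    omega
  have hdy : G.degree y + 2 = Fintype.card V := by
    have := hgood y
    omega
  obtain ⟨x', -, hx'⟩ := huniq y hdy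
  have hxx' : x = x' := by
    rw [← hx']
    have := (hy y).mpr rfl
    exact ⟨hyx, fun h => this.2 h.symm⟩
  subst hxx'
  obtain ⟨p, q, hp, hq, hpq⟩ := hwalk x
  have : q.visits y ⊆ p.visits x := by
    intro i hi
    rw [Walk.mem_visits] at hi ⊢
    have hip : i < p.length := hlen hp hq ▸ hi.1.2
    have := hpq i hi.1.1 hip
    rw [hi.2] at this
    exact ⟨⟨hi.1.1, hip⟩, (hx' _).mp ⟨this.1.symm, fun h => this.2 h.symm⟩⟩
  have := Finset.card_le_card this
  have h1 := hp.degree_eq (hpos hp) x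
  have h2 := hq.degree_eq (hpos hq) y
  rw [if_pos rfl] at h1
  rw [if_neg hyx.symm] at h2
  omega

/-- A doubly Eulerian graph whose order is even and at least `4` has at most `n * (n - 4) / 2`
edges. -/
lemma IsDoublyEulerian.two_mul_ncard_edgeSet_le {V : Type*} [Finite V] {G : SimpleGraph V}
    (hG : G.IsDoublyEulerian) (heven : Even (Nat.card V)) (hcard : 4 ≤ Nat.card V) :
    2 * G.edgeSet.ncard ≤ Nat.card V * (Nat.card V - 4) := by
  classical
  have := Fintype.ofFinite V
  rw [Nat.card_eq_fintype_card] at *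
  rw [← coe_edgeFinset, Set.ncard_coe_finset, ← sum_degrees_eq_twice_card_edges]
  calc ∑ v, G.degree v ≤ ∑ _v : V, (Fintype.card V - 4) := by
        refine Finset.sum_le_sum fun v _ => ?_
        have := hG.degree_add_four_le heven hcard v
        convert Nat.le_sub_of_add_le this
    _ = _ := by simp

end SimpleGraph

/-! ### Two walks side by side -/

namespace SimpleGraph

/-- The steps that two walkers in `G` can make at the same time, when their positions have to be in
the relation `R` before and after the step. -/
def stepGraph {V : Type*} (G : SimpleGraph V) (R : V → V → Prop) : SimpleGraph (V × V) where
  Adj a b := G.Adj a.1 b.1 ∧ G.Adj a.2 b.2 ∧ R a.1 a.2 ∧ R b.1 b.2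
  symm := ⟨fun _ _ h => ⟨h.1.symm, h.2.1.symm, h.2.2.2, h.2.2.1⟩⟩
  loopless := ⟨fun _ h => G.loopless.irrefl _ h.1⟩

/-- The first walker. -/
def stepGraph.fst {V : Type*} (G : SimpleGraph V) (R : V → V → Prop) : G.stepGraph R →g G where
  toFun := Prod.fst
  map_rel' h := h.1

/-- The second walker. -/
def stepGraph.snd {V : Type*} (G : SimpleGraph V) (R : V → V → Prop) : G.stepGraph R →g G where
  toFun := Prod.snd
  map_rel' h := h.2.1

/-- Two walkers who move together in a subgraph. -/
def stepGraph.diag {V : Type*} {G G' : SimpleGraph V} {R : V → V → Prop} (h : G' ≤ G)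
    (hR : ∀ v, R v v) : G' →g G.stepGraph R where
  toFun v := (v, v)
  map_rel' h' := ⟨h h', h h', hR _, hR _⟩

lemma stepGraph.rel_getVert {V : Type*} {G : SimpleGraph V} {R : V → V → Prop} {a b : V × V}
    (w : (G.stepGraph R).Walk a b) (ha : R a.1 a.2) (i : ℕ) :
    R (w.getVert i).1 (w.getVert i).2 := by
  induction w generalizing i with
  | nil => simpa using ha
  | cons h w ih =>
    cases i with
    | zero => simpa using ha
    | succ i => exact ih h.2.2.2 i

lemma stepGraph.exists_walks {V : Type*} {G : SimpleGraph V} {R : V → V → Prop} {a a' b b' : V}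
    (w : (G.stepGraph R).Walk (a, a') (b, b')) :
    ∃ (p : G.Walk a b) (q : G.Walk a' b'),
      p.edges = w.edges.map (Sym2.map Prod.fst) ∧ q.edges = w.edges.map (Sym2.map Prod.snd) ∧
      p.length = w.length ∧ q.length = w.length ∧
      (∀ i, p.getVert i = (w.getVert i).1) ∧ ∀ i, q.getVert i = (w.getVert i).2 :=
  ⟨w.map (stepGraph.fst G R), w.map (stepGraph.snd G R), w.edges_map _, w.edges_map _,
    w.length_map _, w.length_map _, w.getVert_map _, w.getVert_map _⟩

lemma exists_walk_edges_eq_map_range {V : Type*} (H : SimpleGraph V) (f : ℕ → V) (k : ℕ)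
    (h : ∀ i < k, H.Adj (f (i + 1)) (f i)) :
    ∃ w : H.Walk (f k) (f 0), w.edges = (List.range k).reverse.map fun i => s(f (i + 1), f i) := by
  induction k with
  | zero => exact ⟨.nil, rfl⟩
  | succ k ih =>
    obtain ⟨w, hw⟩ := ih fun i hi => h i (by omega)
    exact ⟨.cons (h k (by omega)) w, by simp [hw, List.range_succ]⟩

/-- The edges, written in terms of indices of vertices, that the two circuits do not use at the
same time. -/
def detourEdges (m : ℕ) : List (Sym2 ℕ) :=
  [s(0, 2), s(2, 1), s(1, 2 * m + 2), s(2, 2 * m + 3), s(0, 2 * m + 1)] ++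
    ((List.range m).map (fun i => s(2 * i + 4, 2 * i + 2)) ++
      (List.range (m + 1)).map fun i => s(2 * i + 3, 2 * i + 1))

lemma mem_detourEdges {m : ℕ} {e : Sym2 ℕ} (he : e ∈ detourEdges m) :
    e = s(1, 2) ∨ ∃ i j, e = s(i, j) ∧ j ≤ 2 * m + 3 ∧ (j = i + 2 ∨ j = i + (2 * m + 1)) := by
  simp only [detourEdges, List.mem_append, List.mem_cons, List.not_mem_nil, or_false, List.mem_map,
    List.mem_range] at he
  rcases he with (rfl | rfl | rfl | rfl | rfl) | ⟨i, hi, rfl⟩ | ⟨i, hi, rfl⟩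
  · exact .inr ⟨0, 2, rfl, by omega, by omega⟩
  · exact .inl Sym2.eq_swap
  · exact .inr ⟨_, _, rfl, by omega, by omega⟩
  · exact .inr ⟨_, _, rfl, by omega, by omega⟩
  · exact .inr ⟨_, _, rfl, by omega, by omega⟩
  · exact .inr ⟨_, _, Sym2.eq_swap, by omega, by omega⟩
  · exact .inr ⟨_, _, Sym2.eq_swap, by omega, by omega⟩

lemma nodup_detourEdges {m : ℕ} (hm : 1 ≤ m) : (detourEdges m).Nodup := by
  simp only [detourEdges, List.nodup_append, List.nodup_cons, List.mem_cons, List.not_mem_nil,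
    or_false, not_or, List.mem_map, List.mem_range, List.mem_append, Sym2.eq_iff]
  refine ⟨by simp; omega, ⟨?_, ?_, ?_⟩, ?_⟩
  · refine List.nodup_range.map fun i j h => ?_
    simp only [Sym2.eq_iff] at h
    omega
  · refine List.nodup_range.map fun i j h => ?_
    simp only [Sym2.eq_iff] at h
    omega
  · rintro _ ⟨i, hi, rfl⟩ _ ⟨j, hj, rfl⟩ h
    simp only [Sym2.eq_iff] at h
    omega
  · rintro _ (rfl | rfl | rfl | rfl | rfl) _ (⟨j, hj, rfl⟩ | ⟨j, hj, rfl⟩) h <;>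
      simp only [Sym2.eq_iff] at h <;> omega

/-- The part of the two circuits in which they differ, apart from the first and the last step.
The first one runs through `2, 1, 2m + 2, 2m, …, 2, 2m + 3, 2m + 1, …, 3, 1`.  The second one is at
the same vertex at the start and at the end and one behind in between.  Together with the first and
the last step both use the edges in `detourEdges m`. -/
lemma exists_detour {V : Type*} {G : SimpleGraph V} {c : ℕ → V} {m : ℕ}
    (hm : 1 ≤ m)
    (hadj : ∀ i j, i < j → j ≤ 2 * m + 3 → j ≤ i + 2 * m + 1 → G.Adj (c i) (c j))
    {R : V → V → Prop} (hR : ∀ v, R v v) (hRc : ∀ i, R (c (i + 1)) (c i)) :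
    ∃ w : (G.stepGraph R).Walk (c 2, c 2) (c 1, c 1),
      (s(c 0, c 2) :: (w.edges.map (Sym2.map Prod.fst) ++ [s(c (2 * m + 1), c 0)])).Perm
        ((detourEdges m).map (Sym2.map c)) ∧
      (s(c (2 * m + 3), c 2) ::
        (w.edges.map (Sym2.map Prod.snd) ++ [s(c (2 * m + 1), c (2 * m + 3))])).Perm
        ((detourEdges m).map (Sym2.map c)) := by
  obtain ⟨w1, hw1⟩ := exists_walk_edges_eq_map_range (G.stepGraph R)
    (fun i => (c (2 * i + 2), c (2 * i + 1))) m fun i hi =>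
      ⟨(hadj (2 * i + 2) (2 * (i + 1) + 2) (by omega) (by omega) (by omega)).symm,
        (hadj (2 * i + 1) (2 * (i + 1) + 1) (by omega) (by omega) (by omega)).symm, hRc _, hRc _⟩
  obtain ⟨w2, hw2⟩ := exists_walk_edges_eq_map_range (G.stepGraph R)
    (fun i => (c (2 * i + 3), c (2 * i + 2))) m fun i hi =>
      ⟨(hadj (2 * i + 3) (2 * (i + 1) + 3) (by omega) (by omega) (by omega)).symm,
        (hadj (2 * i + 2) (2 * (i + 1) + 2) (by omega) (by omega) (by omega)).symm, hRc _, hRc _⟩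
  have e1 : (G.stepGraph R).Adj (c 2, c 2) (c 1, c 0) :=
    ⟨(hadj 1 2 (by omega) (by omega) (by omega)).symm,
      (hadj 0 2 (by omega) (by omega) (by omega)).symm, hR _, hRc _⟩
  have e2 : (G.stepGraph R).Adj (c 1, c 0) (c (2 * m + 2), c (2 * m + 1)) :=
    ⟨hadj _ _ (by omega) (by omega) (by omega),
      hadj _ _ (by omega) (by omega) (by omega), hRc _, hRc _⟩
  have e3 : (G.stepGraph R).Adj (c (2 * 0 + 2), c (2 * 0 + 1)) (c (2 * m + 3), c (2 * m + 2)) :=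
    ⟨hadj _ _ (by omega) (by omega) (by omega),
      hadj _ _ (by omega) (by omega) (by omega), hRc _, hRc _⟩
  have e4 : (G.stepGraph R).Adj (c (2 * 0 + 3), c (2 * 0 + 2)) (c 1, c 1) :=
    ⟨(hadj 1 3 (by omega) (by omega) (by omega)).symm,
      (hadj 1 2 (by omega) (by omega) (by omega)).symm, hRc _, hR _⟩
  -- The last list of `detourEdges m`, with its first or its last entry split off.
  have h1 : (List.range (m + 1)).map (fun i => s(c (2 * i + 3), c (2 * i + 1))) =
      s(c 3, c 1) :: (List.range m).map fun i => s(c (2 * (i + 1) + 3), c (2 * i + 3)) := by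
    rw [List.range_succ_eq_map, List.map_cons, List.map_map]
    rfl
  have h2 : (List.range (m + 1)).map (fun i => s(c (2 * i + 3), c (2 * i + 1))) =
      (List.range m).map (fun i => s(c (2 * (i + 1) + 1), c (2 * i + 1))) ++
        [s(c (2 * m + 3), c (2 * m + 1))] := by
    rw [List.range_succ, List.map_append]
    rfl
  have hd : (detourEdges m).map (Sym2.map c) =
      [s(c 0, c 2), s(c 2, c 1), s(c 1, c (2 * m + 2)), s(c 2, c (2 * m + 3)),
        s(c 0, c (2 * m + 1))] ++
      ((List.range m).map (fun i => s(c (2 * (i + 1) + 2), c (2 * i + 2))) ++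
        (List.range (m + 1)).map fun i => s(c (2 * i + 3), c (2 * i + 1))) := by
    simp only [detourEdges, List.map_append, List.map_cons, List.map_nil, Sym2.map_mk, List.map_map]
    rfl
  classical
  refine ⟨.cons e1 (.cons e2 (w1.append (.cons e3 (w2.append (.cons e4 .nil))))), ?_, ?_⟩
  · have hE : w1.edges.map (Sym2.map Prod.fst) =
        ((List.range m).map fun i => s(c (2 * (i + 1) + 2), c (2 * i + 2))).reverse := by
      rw [hw1, List.map_map, ← List.map_reverse]
      rfl
    have hO : w2.edges.map (Sym2.map Prod.fst) =
        ((List.range m).map fun i => s(c (2 * (i + 1) + 3), c (2 * i + 3))).reverse := by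
      rw [hw2, List.map_map, ← List.map_reverse]
      rfl
    rw [hd, h1, List.perm_iff_count]
    intro e
    simp only [Walk.edges_cons, Walk.edges_append, Walk.edges_nil, List.map_cons, List.map_append,
      List.map_nil, Sym2.map_mk, hE, hO, List.count_append, List.count_cons, List.count_reverse,
      List.count_nil, Nat.mul_zero, Nat.zero_add]
    rw [Sym2.eq_swap (a := c (2 * m + 1)) (b := c 0)]
    omega
  · have hE : w1.edges.map (Sym2.map Prod.snd) =
        ((List.range m).map fun i => s(c (2 * (i + 1) + 1), c (2 * i + 1))).reverse := by
      rw [hw1, List.map_map, ← List.map_reverse]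
      rfl
    have hO : w2.edges.map (Sym2.map Prod.snd) =
        ((List.range m).map fun i => s(c (2 * (i + 1) + 2), c (2 * i + 2))).reverse := by
      rw [hw2, List.map_map, ← List.map_reverse]
      rfl
    rw [hd, h2, List.perm_iff_count]
    intro e
    simp only [Walk.edges_cons, Walk.edges_append, Walk.edges_nil, List.map_cons, List.map_append,
      List.map_nil, Sym2.map_mk, hE, hO, List.count_append, List.count_cons, List.count_reverse,
      List.count_nil, Nat.mul_zero, Nat.zero_add]
    rw [Sym2.eq_swap (a := c (2 * m + 1)) (b := c (2 * m + 3)),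
      Sym2.eq_swap (a := c (2 * m + 3)) (b := c 2), Sym2.eq_swap (a := c 2) (b := c 0)]
    omega

/-- Two circuits, one at `c 0` and one at `c (2 * m + 3)`, that make the detour and go together
along an Eulerian trail of the remaining edges. -/
lemma exists_eulerian_pair {V : Type*} [Finite V] {G : SimpleGraph V} {c : ℕ → V} {m : ℕ}
    (hm : 1 ≤ m) (hinj : Set.InjOn c (Set.Iic (2 * m + 3)))
    (hadj : ∀ i j, i < j → j ≤ 2 * m + 3 → j ≤ i + 2 * m + 1 → G.Adj (c i) (c j))
    (heven : ∀ x, Even (G.incidenceSet x).ncard)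
    (hconn : (G.deleteEdges {e | e ∈ (detourEdges m).map (Sym2.map c)}).Preconnected)
    {R : V → V → Prop} (hR : ∀ v, R v v) (hRc : ∀ i, R (c (i + 1)) (c i)) :
    ∃ (p : G.Walk (c 0) (c 0)) (q : G.Walk (c (2 * m + 3)) (c (2 * m + 3))),
      (p.IsTrail ∧ ∀ e ∈ G.edgeSet, e ∈ p.edges) ∧ (q.IsTrail ∧ ∀ e ∈ G.edgeSet, e ∈ q.edges) ∧
      ∀ i, 0 < i → i < p.length → R (p.getVert i) (q.getVert i) := by
  classical
  obtain ⟨w, hp, hq⟩ := exists_detour hm hadj hR hRc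
  set A := (detourEdges m).map (Sym2.map c) with hA
  have hAnodup : A.Nodup := by
    refine List.Nodup.map_on ?_ (nodup_detourEdges hm)
    have hmem : ∀ e ∈ detourEdges m, ∃ i j, e = s(i, j) ∧ i ≤ 2 * m + 3 ∧ j ≤ 2 * m + 3 := by
      intro e he
      rcases mem_detourEdges he with rfl | ⟨i, j, rfl, h⟩
      · exact ⟨1, 2, rfl, by omega, by omega⟩
      · exact ⟨i, j, rfl, by omega, by omega⟩
    intro e he f hf hef
    obtain ⟨i, j, rfl, hi, hj⟩ := hmem e he
    obtain ⟨k, l, rfl, hk, hl⟩ := hmem f hf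
    simp only [Sym2.map_mk, Sym2.eq_iff] at hef ⊢
    exact hef.imp (fun h => ⟨hinj hi hk h.1, hinj hj hl h.2⟩)
      (fun h => ⟨hinj hi hl h.1, hinj hj hk h.2⟩)
  have h02 : G.Adj (c 0) (c 2) := hadj _ _ (by omega) (by omega) (by omega)
  have hl0 : G.Adj (c (2 * m + 1)) (c 0) := (hadj _ _ (by omega) (by omega) (by omega)).symm
  have hl2 : G.Adj (c (2 * m + 3)) (c 2) := (hadj _ _ (by omega) (by omega) (by omega)).symm
  have hll : G.Adj (c (2 * m + 1)) (c (2 * m + 3)) := hadj _ _ (by omega) (by omega) (by omega)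
  -- The part of the first circuit outside the common trail is a trail itself.
  obtain ⟨wp, -, hwp, -⟩ := stepGraph.exists_walks w
  let r : G.Walk (c (2 * m + 1)) (c 1) := .cons hl0 (.cons h02 wp)
  have hr : r.edges.Perm A := by
    refine List.Perm.trans ?_ hp
    simp only [r, Walk.edges_cons, hwp]
    exact (List.perm_append_comm (l₁ := [s(c (2 * m + 1), c 0)])).trans (by simp)
  have hrtrail : r.IsTrail := (Walk.isTrail_def _).mpr (hr.nodup_iff.mpr hAnodup)
  have hrset : r.edgeSet = {e | e ∈ A} := by
    ext e
    exact hr.mem_iff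
  obtain ⟨t, ht, htall⟩ := exists_isTrail_forall_mem_edges hconn (c 1) (c (2 * m + 1)) (by
    intro x
    have h1 := hrtrail.ncard_incidenceSet x
    have h2 := hrtrail.even_countP_edges_iff x
    have h3 := heven x
    rw [h1, hrset, Nat.even_add, h2] at h3
    rw [h3]
    tauto)
  have htA : ∀ e ∈ t.edges, e ∈ G.edgeSet ∧ e ∉ A := by
    intro e he
    have := t.edges_subset_edgeSet he
    rwa [edgeSet_deleteEdges] at this
  obtain ⟨td, htd⟩ : ∃ td : (G.stepGraph R).Walk (c 1, c 1) (c (2 * m + 1), c (2 * m + 1)),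
      td.edges = t.edges.map (Sym2.map fun v => (v, v)) :=
    ⟨t.map (stepGraph.diag (deleteEdges_le _) hR), t.edges_map _⟩
  set z : (G.stepGraph R).Walk (c 2, c 2) (c (2 * m + 1), c (2 * m + 1)) :=
    w.append td with hz
  have hcover : ∀ l : List (Sym2 V), l.Perm (t.edges ++ A) →
      l.Nodup ∧ ∀ e ∈ G.edgeSet, e ∈ l := by
    intro l hl
    refine ⟨hl.nodup_iff.mpr (List.nodup_append.mpr ⟨ht.edges_nodup, hAnodup, ?_⟩), ?_⟩
    · rintro e he _ hf rfl
      exact (htA e he).2 hf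
    · intro e he
      rw [hl.mem_iff, List.mem_append]
      by_cases heA : e ∈ A
      · exact .inr heA
      · refine .inl (htall e ?_)
        rw [edgeSet_deleteEdges]
        exact ⟨he, heA⟩
  have hdiag1 : z.edges.map (Sym2.map Prod.fst) = w.edges.map (Sym2.map Prod.fst) ++ t.edges := by
    rw [hz, Walk.edges_append, htd, List.map_append, List.map_map, ← Sym2.map_comp]
    exact congrArg _ <| (List.map_congr_left fun e _ => congrFun Sym2.map_id e).trans (List.map_id _)
  have hdiag2 : z.edges.map (Sym2.map Prod.snd) = w.edges.map (Sym2.map Prod.snd) ++ t.edges := by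
    rw [hz, Walk.edges_append, htd, List.map_append, List.map_map, ← Sym2.map_comp]
    exact congrArg _ <| (List.map_congr_left fun e _ => congrFun Sym2.map_id e).trans (List.map_id _)
  obtain ⟨zp, zq, hzp, hzq, hlp, hlq, hvp, hvq⟩ := stepGraph.exists_walks z
  refine ⟨.cons h02 (zp.append (.cons hl0 .nil)), .cons hl2 (zq.append (.cons hll .nil)),
    ?_, ?_, ?_⟩
  · rw [Walk.isTrail_def]
    apply hcover
    refine List.Perm.trans ?_ (List.Perm.append_left _ hp)
    rw [List.perm_iff_count]
    intro e
    simp only [Walk.edges_cons, Walk.edges_append, Walk.edges_nil, hzp, hdiag1,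
      List.count_append, List.count_cons, List.count_nil]
    omega
  · rw [Walk.isTrail_def]
    apply hcover
    refine List.Perm.trans ?_ (List.Perm.append_left _ hq)
    rw [List.perm_iff_count]
    intro e
    simp only [Walk.edges_cons, Walk.edges_append, Walk.edges_nil, hzq, hdiag2,
      List.count_append, List.count_cons, List.count_nil]
    omega
  · intro i hi hil
    obtain ⟨i, rfl⟩ : ∃ j, i = j + 1 := ⟨i - 1, by omega⟩
    rw [Walk.getVert_cons_succ, Walk.getVert_cons_succ, Walk.getVert_append, Walk.getVert_append,
      hlp, hlq, hvp, hvq]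
    simp only [Walk.length_cons, Walk.length_append, Walk.length_nil, hlp] at hil
    split_ifs with h
    · exact stepGraph.rel_getVert z (hR _) i
    · have : i - z.length = 0 := by omega
      rw [this, Walk.getVert_zero, Walk.getVert_zero]
      exact hR _

end SimpleGraph

/-! ### The circulant graph -/

namespace SimpleGraph

lemma ncard_incidenceSet_eq {V : Type*} (G : SimpleGraph V) (x : V) :
    (G.incidenceSet x).ncard = (G.neighborSet x).ncard := by
  classical
  exact Nat.card_congr (G.incidenceSetEquivNeighborSet x)

open Classical in
lemma isDoublyEulerian_of_isTrail {V : Type*} {G : SimpleGraph V} (hG : G.Connected)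
    (h : ∀ x, ∃ p q : G.Walk x x, (p.IsTrail ∧ ∀ e ∈ G.edgeSet, e ∈ p.edges) ∧
      (q.IsTrail ∧ ∀ e ∈ G.edgeSet, e ∈ q.edges) ∧ p.Avoiding q) : G.IsDoublyEulerian := by
  refine ⟨hG, fun x => ?_⟩
  obtain ⟨p, q, hp, hq, hpq⟩ := h x
  exact ⟨p, q, (Walk.isEulerian_iff _).mpr hp, (Walk.isEulerian_iff _).mpr hq, hpq⟩

/-- An automorphism carries the circuit `p` to a circuit at `x` that uses every edge once. -/
lemma Walk.exists_map_iso {V : Type*} {G : SimpleGraph V} (φ : G ≃g G) {u x : V} (hx : φ u = x)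
    {p : G.Walk u u} (hp : p.IsTrail ∧ ∀ e ∈ G.edgeSet, e ∈ p.edges) :
    ∃ q : G.Walk x x, (q.IsTrail ∧ ∀ e ∈ G.edgeSet, e ∈ q.edges) ∧ q.length = p.length ∧
      ∀ i, q.getVert i = φ (p.getVert i) := by
  subst hx
  refine ⟨p.map φ.toHom, ⟨hp.1.map φ.injective, fun e he => ?_⟩, p.length_map _, p.getVert_map _⟩
  rw [Walk.edges_map, List.mem_map]
  induction e with
  | h a b =>
    refine ⟨s(φ.symm a, φ.symm b), hp.2 _ (φ.symm.map_rel_iff.mpr he), ?_⟩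
    simp [Sym2.map_mk]

/-- The jumps `1, …, n / 2 - 2` of the edge-maximal doubly Eulerian circulant graph of order
`n = 4 * m + 6`.  With `N = n / 2`, a vertex `x` is not adjacent to `x`, `x + N - 1`, `x + N` and
`x + N + 1`. -/
def jumps (m : ℕ) : Set (ZMod (4 * m + 6)) :=
  {s | 0 < s.val ∧ s.val ≤ 2 * m + 1}

variable {m : ℕ}

lemma circulantGraph_jumps_adj {x y : ZMod (4 * m + 6)} :
    (circulantGraph (jumps m)).Adj x y ↔
      0 < (y - x).val ∧ ((y - x).val ≤ 2 * m + 1 ∨ 2 * m + 5 ≤ (y - x).val) := by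
  have h1 : x - y = -(y - x) := by ring
  have h2 := (y - x).val_lt
  simp only [circulantGraph_adj, jumps, Set.mem_ofPred_eq]
  rw [h1, ZMod.neg_val]
  by_cases h : y - x = 0
  · simp [h]
  · have h3 : 0 < (y - x).val := by
      rw [Nat.pos_iff_ne_zero, Ne, ZMod.val_eq_zero]
      exact h
    have h4 : x ≠ y := by
      rintro rfl
      simp at h
    rw [if_neg h]
    simp only [h4, not_false_eq_true, true_and]
    omega

lemma natCast_inj_of_lt {n a b : ℕ} (ha : a < n) (hb : b < n)
    (h : (a : ZMod n) = (b : ZMod n)) : a = b := by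
  rw [← ZMod.val_natCast_of_lt ha, h, ZMod.val_natCast_of_lt hb]

lemma circulantGraph_jumps_adj_add {x : ZMod (4 * m + 6)} {d : ℕ} (hd : d < 4 * m + 6) :
    (circulantGraph (jumps m)).Adj x (x + d) ↔ 0 < d ∧ (d ≤ 2 * m + 1 ∨ 2 * m + 5 ≤ d) := by
  rw [circulantGraph_jumps_adj, add_sub_cancel_left, ZMod.val_natCast_of_lt hd]

lemma ncard_neighborSet_circulantGraph_jumps (x : ZMod (4 * m + 6)) :
    ((circulantGraph (jumps m)).neighborSet x).ncard = 4 * m + 2 := by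
  classical
  have h : (circulantGraph (jumps m)).neighborSet x =
      ((Finset.Ioc 0 (2 * m + 1) ∪ Finset.Ico (2 * m + 5) (4 * m + 6)).image
        fun d : ℕ => x + (d : ZMod (4 * m + 6)) : Finset (ZMod (4 * m + 6))) := by
    ext y
    simp only [mem_neighborSet, Finset.coe_image, Set.mem_image, Finset.mem_coe, Finset.mem_union,
      Finset.mem_Ioc, Finset.mem_Ico]
    constructor
    · intro hy
      have h1 := (y - x).val_lt
      rw [circulantGraph_jumps_adj] at hy
      exact ⟨(y - x).val, by omega, by simp⟩
    · rintro ⟨d, hd, rfl⟩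
      rw [circulantGraph_jumps_adj_add (by omega)]
      omega
  rw [h, Set.ncard_coe_finset, Finset.card_image_of_injOn, Finset.card_union_of_disjoint]
  · simp
    omega
  · rw [Finset.disjoint_left]
    intro d
    simp only [Finset.mem_Ioc, Finset.mem_Ico]
    omega
  · intro a ha b hb hab
    simp only [Finset.coe_union, Set.mem_union, Finset.mem_coe, Finset.mem_Ioc,
      Finset.mem_Ico] at ha hb
    exact natCast_inj_of_lt (by omega) (by omega) (add_left_cancel hab)

/-- The only edge of the Hamiltonian cycle `0, 1, 2, …` that is used by the detour is the one
between `1` and `2`. -/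
lemma not_mem_detourEdges_map {x : ZMod (4 * m + 6)} (hx : x ≠ ((1 : ℕ) : ZMod (4 * m + 6)))
    (hm : 1 ≤ m) :
    s(x, x + 1) ∉ (detourEdges m).map (Sym2.map (Nat.cast : ℕ → ZMod (4 * m + 6))) := by
  intro h
  rw [List.mem_map] at h
  obtain ⟨e, he, hex⟩ := h
  rcases mem_detourEdges he with rfl | ⟨i, j, rfl, hj, hk⟩
  · rw [Sym2.map_mk, Sym2.eq_iff] at hex
    rcases hex with ⟨h1, h2⟩ | ⟨h1, h2⟩
    · exact hx h1.symm
    · rw [← h2] at h1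
      have h3 : ((1 : ℕ) : ZMod (4 * m + 6)) = ((3 : ℕ) : ZMod (4 * m + 6)) := by
        rw [h1]
        push_cast
        ring
      have := natCast_inj_of_lt (by omega) (by omega) h3
      omega
  · obtain ⟨k, rfl, hk⟩ : ∃ k, j = i + k ∧ (k = 2 ∨ k = 2 * m + 1) := ⟨j - i, by omega, by omega⟩
    rw [Sym2.map_mk, Sym2.eq_iff, Nat.cast_add] at hex
    rcases hex with ⟨h1, h2⟩ | ⟨h1, h2⟩
    · rw [h1] at h2
      have h3 : ((k : ℕ) : ZMod (4 * m + 6)) = ((1 : ℕ) : ZMod (4 * m + 6)) := by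
        rw [add_left_cancel h2, Nat.cast_one]
      have := natCast_inj_of_lt (by omega) (by omega) h3
      omega
    · have h3 : ((k + 1 : ℕ) : ZMod (4 * m + 6)) = ((0 : ℕ) : ZMod (4 * m + 6)) := by
        rw [h1] at h2
        rw [Nat.cast_zero, Nat.cast_add, Nat.cast_one]
        linear_combination h2
      have := natCast_inj_of_lt (by omega) (by omega) h3
      omega

lemma preconnected_deleteEdges_detourEdges (hm : 1 ≤ m) :
    ((circulantGraph (jumps m)).deleteEdges
      {e | e ∈ (detourEdges m).map (Sym2.map (Nat.cast : ℕ → ZMod (4 * m + 6)))}).Preconnected := by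
  set H := (circulantGraph (jumps m)).deleteEdges
    {e | e ∈ (detourEdges m).map (Sym2.map (Nat.cast : ℕ → ZMod (4 * m + 6)))} with hH
  have hreach : ∀ k : ℕ, k ≤ 4 * m + 5 →
      H.Reachable ((2 : ℕ) : ZMod (4 * m + 6)) ((2 + k : ℕ) : ZMod (4 * m + 6)) := by
    intro k
    induction k with
    | zero => exact fun _ => Reachable.refl _
    | succ k ih =>
      intro hk
      refine (ih (by omega)).trans (Adj.reachable ?_)
      have h1 : ((2 + (k + 1) : ℕ) : ZMod (4 * m + 6)) =
          ((2 + k : ℕ) : ZMod (4 * m + 6)) + ((1 : ℕ) : ZMod (4 * m + 6)) := by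
        rw [← Nat.cast_add, add_assoc]
      rw [hH, deleteEdges_adj, h1]
      refine ⟨(circulantGraph_jumps_adj_add (by omega)).mpr (by omega), ?_⟩
      rw [Nat.cast_one]
      refine not_mem_detourEdges_map (fun h => ?_) hm
      have h2 : ((k + 1 : ℕ) : ZMod (4 * m + 6)) = ((0 : ℕ) : ZMod (4 * m + 6)) := by
        push_cast at h ⊢
        linear_combination h
      have := natCast_inj_of_lt (by omega) (by omega) h2
      omega
  have hall : ∀ x, H.Reachable ((2 : ℕ) : ZMod (4 * m + 6)) x := by
    intro x
    have h1 := (x - 2).val_lt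
    have h2 := hreach (x - 2).val (by omega)
    rwa [Nat.cast_add, ZMod.natCast_zmod_val, Nat.cast_ofNat, add_sub_cancel] at h2
  exact fun x y => (hall x).symm.trans (hall y)

/-- The circuit at the antipode `N` of `0` is always at the vertex of the circuit at `0` or one
behind it, so that its image under the translation by `N` avoids the circuit at `0`. -/
lemma isDoublyEulerian_circulantGraph_jumps (hm : 1 ≤ m) :
    (circulantGraph (jumps m)).IsDoublyEulerian := by
  set G := circulantGraph (jumps m) with hG
  have hconn := preconnected_deleteEdges_detourEdges hm
  refine isDoublyEulerian_of_isTrail ⟨hconn.mono (deleteEdges_le _)⟩ fun x => ?_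
  have hcast : ∀ i : ℕ, ((i + 1 : ℕ) : ZMod (4 * m + 6)) = (i : ZMod (4 * m + 6)) + 1 :=
    fun i => by push_cast; rfl
  obtain ⟨p, q, hp, hq, hpq⟩ := exists_eulerian_pair (G := G)
    (c := (Nat.cast : ℕ → ZMod (4 * m + 6))) hm
    (fun a ha b hb h => by
      rw [Set.mem_Iic] at ha hb
      exact natCast_inj_of_lt (by omega) (by omega) h)
    (fun i j hij hj hji => by
      obtain ⟨d, rfl⟩ : ∃ d, j = i + d := ⟨j - i, by omega⟩
      rw [Nat.cast_add, hG, circulantGraph_jumps_adj_add (by omega)]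
      omega)
    (fun y => by
      rw [ncard_incidenceSet_eq, ncard_neighborSet_circulantGraph_jumps]
      exact ⟨2 * m + 1, by ring⟩)
    hconn (R := fun v w => v = w ∨ v = w + 1) (fun v => .inl rfl) (fun i => .inr (hcast i))
  let τ : ZMod (4 * m + 6) → (G ≃g G) := fun t =>
    ⟨Equiv.addRight t, circulantGraph_adj_translate⟩
  have hτ : ∀ t y, τ t y = y + t := fun _ _ => rfl
  obtain ⟨p', hp', hlen, hpv⟩ := Walk.exists_map_iso (τ x) (x := x)
    (show ((0 : ℕ) : ZMod (4 * m + 6)) + x = x by simp) hp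
  obtain ⟨q', hq', -, hqv⟩ := Walk.exists_map_iso (τ (x + ((2 * m + 3 : ℕ) : ZMod (4 * m + 6))))
    (x := x) (show ((2 * m + 3 : ℕ) : ZMod (4 * m + 6)) +
      (x + ((2 * m + 3 : ℕ) : ZMod (4 * m + 6))) = x by
        have : ((4 * m + 6 : ℕ) : ZMod (4 * m + 6)) = 0 := ZMod.natCast_self _
        push_cast at this ⊢
        linear_combination this) hq
  refine ⟨p', q', hp', hq', ?_⟩
  intro i hi hil
  have hR := hpq i hi (hlen ▸ hil)
  rw [hpv, hqv, hτ, hτ]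
  generalize p.getVert i = v at hR ⊢
  generalize q.getVert i = w at hR ⊢
  obtain ⟨d, hd, hvw⟩ : ∃ d : ℕ, (d = 2 * m + 2 ∨ d = 2 * m + 3) ∧
      w + (x + ((2 * m + 3 : ℕ) : ZMod (4 * m + 6))) = v + x + (d : ZMod (4 * m + 6)) := by
    rcases hR with rfl | rfl
    · exact ⟨2 * m + 3, .inr rfl, by ring⟩
    · refine ⟨2 * m + 2, .inl rfl, ?_⟩
      push_cast
      ring
  rw [hvw, hG, circulantGraph_jumps_adj_add (by omega)]
  refine ⟨fun h => ?_, by omega⟩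
  have h1 : ((0 : ℕ) : ZMod (4 * m + 6)) = (d : ZMod (4 * m + 6)) := by
    rw [Nat.cast_zero]
    exact left_eq_add.mp h |>.symm
  have := natCast_inj_of_lt (by omega) (by omega) h1
  omega

end SimpleGraph

theorem mainTheorem3 (n : ℕ) (hmod : n ≡ 2 [MOD 4]) (hn : 10 ≤ n) :
    ∃ S : Set (ZMod n),
      (SimpleGraph.circulantGraph S).IsEdgeMaximalDoublyEulerian ∧
      ∃ _ : (SimpleGraph.circulantGraph S).LocallyFinite,
        (SimpleGraph.circulantGraph S).IsRegularOfDegree (n - 4) := by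
  obtain ⟨m, hm, rfl⟩ : ∃ m, 1 ≤ m ∧ n = 4 * m + 6 := by
    have : n % 4 = 2 := hmod
    exact ⟨(n - 6) / 4, by omega, by omega⟩
  classical
  have hdeg : ∀ x, (SimpleGraph.circulantGraph (SimpleGraph.jumps m)).degree x = 4 * m + 2 := by
    intro x
    rw [← SimpleGraph.ncard_neighborSet_circulantGraph_jumps x, ← Nat.card_coe_set_eq,
      Nat.card_eq_fintype_card, SimpleGraph.card_neighborSet_eq_degree]
  refine ⟨SimpleGraph.jumps m, ⟨SimpleGraph.isDoublyEulerian_circulantGraph_jumps hm, ?_⟩,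
    fun _ => inferInstance, hdeg⟩
  intro W H hW hH
  rw [Nat.card_zmod] at hW
  have : Finite W := Nat.finite_of_card_ne_zero (by omega)
  have h1 := hH.two_mul_ncard_edgeSet_le (by rw [hW]; exact ⟨2 * m + 3, by ring⟩) (by omega)
  have h2 := (SimpleGraph.circulantGraph (SimpleGraph.jumps m)).sum_degrees_eq_twice_card_edges
  rw [Finset.sum_congr rfl fun x _ => hdeg x, Finset.sum_const, Finset.card_univ, ZMod.card,
    ← Set.ncard_coe_finset, SimpleGraph.coe_edgeFinset, smul_eq_mul] at h2
  rw [hW, show 4 * m + 6 - 4 = 4 * m + 2 by omega] at h1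
  omega
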